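/- Every matching problem with linearly transferable utility (LTU) with finitely many types and bounded-size arrangements has a stable outcome. Precisely: (a) Arrangements of up to $N$ members. Let $X$ be a finite set of types, $n_x\ge 0$ the mass of individuals of type $x$, $N\in\mathbb N$, and let $A\subset (X\cup\{0\})^N$ be a set of allowed arrangements $a=(x_1,\dots,x_N)$, where $x_i=0$ means that spot $i$ is vacant. Assume that $(0,\dots,0)\notin A$ and that for every $x\in X$ the set $A$ contains an arrangement in which $x$ is single (one spot is taken by $x$ and all the others are vacant). For each $a\in A$ let $\Phi_a\in\mathbb R$ be given, as well as $\lambda_{1,a},\dots,\lambda_{N,a}\ge 0$ with $\sum_i\lambda_{i,a}=1$ and $\lambda_{i,a}=0$ if and only if $x_i=0$. Write $M_{x,a}$ for the number of spots of $a$ taken by type $x$. Then there exists a stable outcome $(\mu,u)$, that is, numbers $\mu_a\ge 0$ $(a\in A)$ and $u_x\in\mathbb R$ $(x\in X)$ such that $$\sum_{a\in A} M_{x,a}\,\mu_a=n_x\quad\forall x\in X,\qquad \sum_{i:\,x_i\ne 0}\lambda_{i,a}\,u_{x_i}\ \ge\ \Phi_a\quad\forall a\in A,$$ with equality in the second condition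 whenever $\mu_a>0$. (b) Two-sided matching. Let $X$ (worker types) and $Y$ (job types) be finite sets, with masses $n_x,m_y\ge0$, and for all $x\in X$, $y\in Y$ let $\lambda_{xy}\in(0,1)$ and $\Phi_{xy}\in\mathbb R$. Let $\underline u_x,\underline v_y\in\mathbb R$ be the reservation utilities (equal to $0$ in the usual normalization). Then there exists a stable outcome $(\mu,u,v)$, that is, $\mu_{xy}\ge0$, $u_x\ge\underline u_x$, $v_y\ge\underline v_y$ such that for all $x\in X$ and $y\in Y$ $$\lambda_{xy}u_x+(1-\lambda_{xy})v_y\ge\Phi_{xy}/2,\qquad \sum_{y'}\mu_{xy'}\le n_x,\qquad \sum_{x'}\mu_{x'y}\le m_y,$$ where the first condition holds with equality if $\mu_{xy}>0$, the second if $u_x>\underline u_x$, and the third if $v_y>\underline v_y$. -/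

import Mathlib

/-- A matching problem with linearly transferable utility (LTU) in arrangements of up to `N`
members.  An arrangement is an `N`-tuple `a : Fin N → Option X`: seat `i` is taken by an
individual of type `x` when `a i = some x`, and is vacant when `a i = none`. -/
structure LTUProblem (X : Type*) (N : ℕ) where
  /-- the mass of individuals of type `x` -/
  mass : X → ℝ
  mass_nonneg : ∀ x, 0 ≤ mass x
  /-- the set of allowed arrangements -/
  allowed : Finset (Fin N → Option X)
  /-- the empty arrangement is excluded -/
  empty_notMem : (fun _ => none) ∉ allowed
  /-- every type has at least one allowed arrangement in which it is single -/
  exists_single : ∀ x, ∃ a ∈ allowed, ∃ i, a i = some x ∧ ∀ j, j ≠ i → a j = none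
  /-- the transfer coefficient of seat `i` in the arrangement `a` -/
  coeff : allowed → Fin N → ℝ
  coeff_nonneg : ∀ a i, 0 ≤ coeff a i
  coeff_sum : ∀ a, ∑ i, coeff a i = 1
  coeff_eq_zero_iff : ∀ a i, coeff a i = 0 ↔ a.1 i = none
  /-- the output of the arrangement `a`, of arbitrary sign -/
  output : allowed → ℝ

namespace LTUProblem

variable {X : Type*} {N : ℕ}

/-- The number of individuals of type `x` in the arrangement `a`. -/
def count [DecidableEq X] (x : X) (a : Fin N → Option X) : ℕ :=
  (Finset.univ.filter fun i => a i = some x).card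

/-- The weighted sum of the utilities of the members of `a`; vacant seats contribute nothing. -/
def weightedUtility (P : LTUProblem X N) (u : X → ℝ) (a : P.allowed) : ℝ :=
  ∑ i, P.coeff a i * (a.1 i).elim 0 u

/-- The outcome `(μ, u)` is stable: `μ` is a feasible matching, no allowed arrangement is
blocking, and the utility constraint binds in every arrangement that is formed. -/
structure IsStable [DecidableEq X] (P : LTUProblem X N) (μ : P.allowed → ℝ) (u : X → ℝ) :
    Prop where
  matching_nonneg : ∀ a, 0 ≤ μ a
  feasible : ∀ x, ∑ a : P.allowed, (count x a.1 : ℝ) * μ a = P.mass x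
  no_blocking : ∀ a, P.output a ≤ P.weightedUtility u a
  binding : ∀ a, 0 < μ a → P.weightedUtility u a = P.output a

end LTUProblem

/-- A two-sided (worker-job) LTU matching problem `(X, Y, n, m, lam, Φ, u₀, v₀)`.  The
normalization in which an unmatched individual has utility `0` is `u₀ = 0`, `v₀ = 0`. -/
structure TwoSidedLTUProblem (X Y : Type*) where
  /-- the mass of workers of type `x` -/
  n : X → ℝ
  /-- the mass of jobs of type `y` -/
  m : Y → ℝ
  n_nonneg : ∀ x, 0 ≤ n x
  m_nonneg : ∀ y, 0 ≤ m y
  /-- the transfer coefficient of the match `xy` -/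
  lam : X → Y → ℝ
  lam_pos : ∀ x y, 0 < lam x y
  lam_lt_one : ∀ x y, lam x y < 1
  /-- twice the joint output of the match `xy`, of arbitrary sign -/
  Φ : X → Y → ℝ
  /-- the reservation utility of workers of type `x` -/
  u₀ : X → ℝ
  /-- the reservation utility of employers of type `y` -/
  v₀ : Y → ℝ

/-- The outcome `(μ, u, v)` of the two-sided problem is stable. -/
structure TwoSidedLTUProblem.IsStable {X Y : Type*} [Fintype X] [Fintype Y]
    (P : TwoSidedLTUProblem X Y) (μ : X → Y → ℝ) (u : X → ℝ) (v : Y → ℝ) : Prop where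
  matching_nonneg : ∀ x y, 0 ≤ μ x y
  worker_rational : ∀ x, P.u₀ x ≤ u x
  employer_rational : ∀ y, P.v₀ y ≤ v y
  no_blocking : ∀ x y, P.Φ x y / 2 ≤ P.lam x y * u x + (1 - P.lam x y) * v y
  worker_feasible : ∀ x, ∑ y, μ x y ≤ P.n x
  employer_feasible : ∀ y, ∑ x, μ x y ≤ P.m y
  binding : ∀ x y, 0 < μ x y → P.lam x y * u x + (1 - P.lam x y) * v y = P.Φ x y / 2
  worker_full : ∀ x, P.u₀ x < u x → ∑ y, μ x y = P.n x
  employer_full : ∀ y, P.v₀ y < v y → ∑ x, μ x y = P.m y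

/-! Smooth the complementarity conditions by a Logit rule: at temperature `T`, let `μ a = exp ((Φ a
- ∑ y, C y a * u y) / T)`. All `μ a` are then positive, and stability reduces to clearing the
finitely many type masses in the unknown `u`. Since `Φ a - ∑ y, C y a * u y = T log (μ a)`, bounds
on `μ` and `u` uniform in `T` allow a limit `T → 0`: boundedness of `μ` gives no blocking, and `T
log (μ a) → 0` gives equality wherever the limit of `μ a` is positive.

With unequal transfer coefficients, clearing is not in general the first-order condition of a convex
problem, so a topological argument replaces optimization. Singles make demand too high when a
utility is low; demand vanishes as a utility grows. Excess supply therefore points outward off a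
box, and `exists_zero_of_outward_coordinate` yields a zero. That lemma rests on
`surjective_add_of_hasCompactSupport`, proved by a Milnor-type argument: a volume identity,
polynomial in the deformation parameter, extends from small parameters to all. -/

/-! ### Surjectivity and zeros of vector fields by change of variables -/

theorem setIntegral_polynomial_family_eq_of_small {E : Type*} [MeasurableSpace E]
    (ν : MeasureTheory.Measure E) (Q : E → ℝ → ℝ) (D : ℕ) (V : ℝ)
    (hQ : ∀ x, ∃ P : Polynomial ℝ, P.natDegree ≤ D ∧ ∀ t, P.eval t = Q x t)
    (hint : ∀ t, MeasureTheory.Integrable (fun x => Q x t) ν)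
    (hsmall : ∃ ε > 0, ∀ t, 0 < t → t < ε → ∫ x, Q x t ∂ν = V) (t : ℝ) :
    ∫ x, Q x t ∂ν = V := by
  obtain ⟨ε, hε, hV⟩ := hsmall
  let s : Finset ℕ := Finset.range (D + 1)
  -- These nodes lie in `(0, ε)`. As `D` is uniform in `x`, Lagrange interpolation at them expresses
  -- `Q x t` with weights independent of `x`, which pass through the integral.
  let v : ℕ → ℝ := fun j => ε / (j + 2)
  have hv : Set.InjOn v s := by
    intro i _ j _ hij
    have hi : (0 : ℝ) < i + 2 := by positivity
    have hj : (0 : ℝ) < j + 2 := by positivity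
    simp only [v] at hij
    field_simp at hij
    exact_mod_cast (by linarith : (i : ℝ) = j)
  have hvV : ∀ j, ∫ x, Q x (v j) ∂ν = V := fun j => by
    refine hV _ (by positivity) ?_
    have hj : (0 : ℝ) ≤ j := by positivity
    rw [div_lt_iff₀ (by positivity)]
    nlinarith
  have hLag : ∀ x, Q x t = ∑ j ∈ s, Q x (v j) * (Lagrange.basis s v j).eval t := by
    intro x
    obtain ⟨P, hP, hPe⟩ := hQ x
    have hdeg : P.degree < (s.card : ℕ) := by
      rw [Finset.card_range]
      exact lt_of_le_of_lt P.degree_le_natDegree (by exact_mod_cast Nat.lt_succ_of_le hP)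
    have := Lagrange.eq_interpolate hv hdeg
    rw [← hPe t, this, Lagrange.interpolate_apply, Polynomial.eval_finsetSum]
    simp [hPe]
  calc ∫ x, Q x t ∂ν
      = ∫ x, ∑ j ∈ s, Q x (v j) * (Lagrange.basis s v j).eval t ∂ν := by simp_rw [← hLag]
    _ = ∑ j ∈ s, V * (Lagrange.basis s v j).eval t := by
        rw [MeasureTheory.integral_finsetSum _ fun j _ => (hint (v j)).mul_const _]
        simp_rw [MeasureTheory.integral_mul_const, hvV]
    _ = V := by
        rw [← Finset.mul_sum, ← Polynomial.eval_finsetSum,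
          Lagrange.sum_basis hv ⟨0, by simp [s]⟩]
        simp

theorem ContinuousLinearMap.exists_polynomial_det_one_add_smul {E : Type*}
    [NormedAddCommGroup E] [NormedSpace ℝ E] [FiniteDimensional ℝ E] (A : E →L[ℝ] E) :
    ∃ P : Polynomial ℝ, P.natDegree ≤ Module.finrank ℝ E ∧
      ∀ t : ℝ, P.eval t = (1 + t • A).det := by
  classical
  let b := Module.finBasis ℝ E
  let M := LinearMap.toMatrix b b (A : E →ₗ[ℝ] E)
  refine ⟨Matrix.det ((Polynomial.X : Polynomial ℝ) • M.map Polynomial.C +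
    (1 : Matrix _ _ ℝ).map Polynomial.C), ?_, fun t => ?_⟩
  · simpa using Polynomial.natDegree_det_X_add_C_le M 1
  · rw [← Polynomial.coe_evalRingHom, RingHom.map_det, ContinuousLinearMap.det,
      ← LinearMap.det_toMatrix b]
    congr 1
    simp only [ContinuousLinearMap.toLinearMap_add, ContinuousLinearMap.toLinearMap_smul,
      map_add, map_smul, ContinuousLinearMap.toLinearMap_one, LinearMap.toMatrix_one]
    ext i j
    simp [M, Matrix.one_apply, add_comm]
    ring

theorem bijective_add_smul_of_lipschitz {E : Type*} [NormedAddCommGroup E] [NormedSpace ℝ E]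
    [CompleteSpace E] {h : E → E} {K : NNReal} (hK : LipschitzWith K h) {t : ℝ}
    (ht : |t| * K < 1) : Function.Bijective fun x => x + t • h x := by
  have hcontr : ∀ y : E, ContractingWith (‖t‖₊ * K) fun x => y - t • h x := by
    intro y
    refine ⟨by simpa [← NNReal.coe_lt_coe] using ht, LipschitzWith.of_dist_le_mul fun x x' => ?_⟩
    rw [dist_sub_left, dist_smul₀]
    calc ‖t‖ * dist (h x) (h x') ≤ ‖t‖ * (K * dist x x') := by gcongr; exact hK.dist_le_mul _ _
      _ = _ := by push_cast; ring
  constructor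
  · intro x x' hx
    refine (hcontr (x + t • h x)).fixedPoint_unique' ?_ ?_
    · simp [Function.IsFixedPt]
    · simp only at hx
      rw [hx]
      simp [Function.IsFixedPt]
  · intro y
    have := (hcontr y).fixedPoint_isFixedPt
    rw [Function.IsFixedPt, sub_eq_iff_eq_add] at this
    exact ⟨_, this.symm⟩

-- For small `t` the map `x + t • h x` is a bijection equal to the identity off the ball, so it
-- permutes the ball; its Jacobian is positive, and the change of variables needs no absolute value.
open MeasureTheory Metric in
theorem exists_forall_setIntegral_add_smul_mul_det_eq {E : Type*} [NormedAddCommGroup E]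
    [InnerProductSpace ℝ E] [FiniteDimensional ℝ E] [MeasurableSpace E] [BorelSpace E]
    (ν : Measure E) [ν.IsAddHaarMeasure] {h : E → E} (hh : ContDiff ℝ 1 h)
    (hc : HasCompactSupport h) {R : ℝ} (hR : ∀ x, x ∉ closedBall 0 R → h x = 0) (g : E → ℝ) :
    ∃ ε > 0, ∀ t : ℝ, 0 < t → t < ε →
      ∫ x in closedBall 0 R, g (x + t • h x) * (1 + t • fderiv ℝ h x).det ∂ν =
        ∫ x in closedBall 0 R, g x ∂ν := by
  obtain ⟨K, hK⟩ := hh.lipschitzWith_of_hasCompactSupport hc one_ne_zero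
  have hdet : ∀ᶠ B : E →L[ℝ] E in nhds 0, 0 < (1 + B).det := by
    have hcont : Continuous fun B : E →L[ℝ] E => (1 + B).det :=
      ContinuousLinearMap.continuous_det.comp (continuous_const.add continuous_id)
    refine hcont.continuousAt.eventually_mem (Ioi_mem_nhds ?_)
    simp [ContinuousLinearMap.det]
  obtain ⟨δ, hδ, hδdet⟩ := Metric.eventually_nhds_iff.1 hdet
  have hK1 : (0 : ℝ) < K + 1 := by positivity
  refine ⟨min 1 δ / (K + 1), by positivity, fun t ht0 ht => ?_⟩
  rw [lt_div_iff₀ hK1] at ht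
  have ht1 : t * (K + 1) < 1 := ht.trans_le (min_le_left _ _)
  have htδ : t * (K + 1) < δ := ht.trans_le (min_le_right _ _)
  have hbij := bijective_add_smul_of_lipschitz hK (t := t) (by rw [abs_of_pos ht0]; linarith)
  have himage : (fun x => x + t • h x) '' closedBall 0 R = closedBall 0 R := by
    have hcompl : ∀ x, x ∉ closedBall (0 : E) R → x + t • h x = x := fun x hx => by simp [hR x hx]
    ext y
    constructor
    · rintro ⟨x, hx, rfl⟩
      by_contra hy
      have := hbij.1 (hcompl _ hy)
      simp only at this hy
      rw [this] at hy
      exact hy hx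
    · intro hy
      obtain ⟨x, rfl⟩ := hbij.2 y
      refine ⟨x, ?_, rfl⟩
      by_contra hx
      simp only [hcompl x hx] at hy
      exact hx hy
  have hpos : ∀ x, 0 < (1 + t • fderiv ℝ h x).det := fun x => by
    apply hδdet
    rw [dist_zero_right, norm_smul, Real.norm_of_nonneg ht0.le]
    have := norm_fderiv_le_of_lipschitz ℝ hK (x₀ := x)
    nlinarith
  conv_rhs => rw [← himage]
  rw [integral_image_eq_integral_abs_det_fderiv_smul ν isClosed_closedBall.measurableSet
    (f' := fun x => 1 + t • fderiv ℝ h x) (fun x _ => ?_) hbij.1.injOn]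
  · simp only [abs_of_pos (hpos _), smul_eq_mul, mul_comm]
  · have hd := (hh.differentiable one_ne_zero x).hasFDerivAt
    exact ((hasFDerivAt_id x).add (hd.const_smul t)).hasFDerivWithinAt

-- The integrand along `x + t • h x` is polynomial in `t`, so the identity for small `t` persists at
-- `t = 1`, where injectivity may fail.
open MeasureTheory Metric in
theorem setIntegral_quadratic_pow_mul_det_eq {E : Type*} [NormedAddCommGroup E]
    [InnerProductSpace ℝ E] [FiniteDimensional ℝ E] [MeasurableSpace E] [BorelSpace E]
    (ν : Measure E) [ν.IsAddHaarMeasure] {h : E → E} (hh : ContDiff ℝ 1 h)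
    (hc : HasCompactSupport h) {R : ℝ} (hR : ∀ x, x ∉ closedBall 0 R → h x = 0)
    (p : E) (S : ℝ) (k : ℕ) :
    ∫ x in closedBall 0 R, (1 - ‖x + h x - p‖ ^ 2 / S) ^ k * (1 + fderiv ℝ h x).det ∂ν =
      ∫ x in closedBall 0 R, (1 - ‖x - p‖ ^ 2 / S) ^ k ∂ν := by
  have key := setIntegral_polynomial_family_eq_of_small (ν.restrict (closedBall 0 R))
    (fun x t => (1 - ‖x + t • h x - p‖ ^ 2 / S) ^ k * (1 + t • fderiv ℝ h x).det)
    (k * 2 + Module.finrank ℝ E) _ ?_ ?_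
    (exists_forall_setIntegral_add_smul_mul_det_eq ν hh hc hR
      fun y => (1 - ‖y - p‖ ^ 2 / S) ^ k) 1
  · simpa using key
  · intro x
    obtain ⟨P, hP, hPe⟩ := (fderiv ℝ h x).exists_polynomial_det_one_add_smul
    let q : Polynomial ℝ := Polynomial.C (-‖h x‖ ^ 2 / S) * Polynomial.X ^ 2 +
      Polynomial.C (-(2 * inner ℝ (x - p) (h x)) / S) * Polynomial.X +
      Polynomial.C (1 - ‖x - p‖ ^ 2 / S)
    refine ⟨q ^ k * P, ?_, fun t => ?_⟩
    · refine Polynomial.natDegree_mul_le.trans (add_le_add ?_ hP)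
      exact Polynomial.natDegree_pow_le.trans
        (Nat.mul_le_mul_left _ Polynomial.natDegree_quadratic_le)
    · rw [Polynomial.eval_mul, hPe, Polynomial.eval_pow]
      congr 2
      have : x + t • h x - p = (x - p) + t • h x := by abel
      rw [this, norm_add_sq_real, inner_smul_right, norm_smul, mul_pow, Real.norm_eq_abs, sq_abs]
      simp [q]
      ring
  · intro t
    have hf := hh.continuous_fderiv one_ne_zero
    have hd : Continuous fun x => (1 + t • fderiv ℝ h x).det :=
      ContinuousLinearMap.continuous_det.comp (continuous_const.add (hf.const_smul t))
    have hh' := hh.continuous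
    exact (Continuous.continuousOn (by fun_prop)).integrableOn_compact (isCompact_closedBall 0 R)

open MeasureTheory Metric in
/-- A continuously differentiable perturbation of the identity with compact support is onto. -/
theorem surjective_add_of_hasCompactSupport {E : Type*} [NormedAddCommGroup E]
    [InnerProductSpace ℝ E] [FiniteDimensional ℝ E] {h : E → E} (hh : ContDiff ℝ 1 h)
    (hc : HasCompactSupport h) : Function.Surjective fun x => x + h x := by
  borelize E
  intro p
  by_contra! hp
  let ν : Measure E := Measure.addHaar
  obtain ⟨R, hRp, hR⟩ : ∃ R, ‖p‖ + 1 ≤ R ∧ ∀ x, x ∉ closedBall 0 R → h x = 0 := by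
    obtain ⟨R, hR⟩ := hc.isCompact.isBounded.subset_closedBall 0
    refine ⟨max R (‖p‖ + 1), le_max_right _ _, fun x hx => ?_⟩
    by_contra hne
    exact hx (closedBall_subset_closedBall (le_max_left _ _)
      (hR (subset_tsupport _ (by simpa using hne))))
  have hcomp : IsCompact (closedBall (0 : E) R) := isCompact_closedBall 0 R
  have hh' := hh.continuous
  have hne : (closedBall (0 : E) R).Nonempty := ⟨0, by simp; linarith [norm_nonneg p]⟩
  obtain ⟨x₀, -, hx₀⟩ := hcomp.exists_isMinOn hne
    (Continuous.continuousOn (by fun_prop : Continuous fun x => ‖x + h x - p‖ ^ 2))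
  obtain ⟨x₁, -, hx₁⟩ := hcomp.exists_isMaxOn hne
    (Continuous.continuousOn (by fun_prop : Continuous fun x => ‖x + h x - p‖ ^ 2))
  obtain ⟨x₂, -, hx₂⟩ := hcomp.exists_isMaxOn hne
    (Continuous.continuousOn (by fun_prop : Continuous fun x => ‖x - p‖ ^ 2))
  rw [isMinOn_iff] at hx₀
  rw [isMaxOn_iff] at hx₁ hx₂
  -- If `p` is missed, the deformed map stays at squared distance at least `δ` from it. Dividing by
  -- `S` puts both bases in `[0, 1]`. The deformed integral is then at most `r ^ k * C`, while the
  -- ball of radius `ρ` about `p` forces at least `r' ^ k * v` with `r < r'`: impossible for large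
  -- `k`.
  set δ := ‖x₀ + h x₀ - p‖ ^ 2 with hδ
  have hδ0 : 0 < δ := by
    have := norm_pos_iff.2 (sub_ne_zero.2 (hp x₀))
    positivity
  set S := ‖x₁ + h x₁ - p‖ ^ 2 + ‖x₂ - p‖ ^ 2 + δ with hS
  have hS0 : 0 < S := by positivity
  have hSδ : δ ≤ S := by rw [hS]; linarith [sq_nonneg ‖x₁ + h x₁ - p‖, sq_nonneg ‖x₂ - p‖]
  set r := 1 - δ / S
  set r' := 1 - δ / 2 / S
  have hr0 : 0 ≤ r := sub_nonneg.2 ((div_le_one hS0).2 hSδ)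
  have hrr' : r < r' := by
    have : δ / 2 / S < δ / S := by gcongr; linarith
    simp only [r, r']; linarith
  have hr'0 : 0 < r' := hr0.trans_lt hrr'
  set C := ∫ x in closedBall 0 R, |(1 + fderiv ℝ h x).det| ∂ν with hC
  have hdet : Continuous fun x => (1 + fderiv ℝ h x).det :=
    ContinuousLinearMap.continuous_det.comp
      (continuous_const.add (hh.continuous_fderiv one_ne_zero))
  have hupper : ∀ k : ℕ, ∫ x in closedBall 0 R, (1 - ‖x - p‖ ^ 2 / S) ^ k ∂ν ≤ r ^ k * C := by
    intro k
    rw [← setIntegral_quadratic_pow_mul_det_eq ν hh hc hR p S k, hC, ← integral_const_mul]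
    refine setIntegral_mono_on ?_ ?_ hcomp.measurableSet fun x hx => ?_
    · exact (Continuous.continuousOn (by fun_prop)).integrableOn_compact hcomp
    · exact (Continuous.continuousOn (by fun_prop)).integrableOn_compact hcomp
    · have h0 : 0 ≤ 1 - ‖x + h x - p‖ ^ 2 / S := sub_nonneg.2 ((div_le_one hS0).2 (by
        have := hx₁ x hx
        rw [hS]; linarith [sq_nonneg ‖x₂ - p‖]))
      have h1 : 1 - ‖x + h x - p‖ ^ 2 / S ≤ r := by
        have := hx₀ x hx
        simp only [r]; gcongr
      refine (mul_le_mul_of_nonneg_left (le_abs_self _) (pow_nonneg h0 k)).trans ?_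
      gcongr
  set ρ := min 1 (√(δ / 2)) with hρ
  have hρ0 : 0 < ρ := by positivity
  have hsub : closedBall p ρ ⊆ closedBall 0 R := by
    refine closedBall_subset_closedBall' ?_
    rw [dist_zero_right]
    linarith [min_le_left 1 (√(δ / 2))]
  set v := ν.real (closedBall p ρ) with hv
  have hv0 : 0 < v := by
    rw [hv, measureReal_def]
    exact ENNReal.toReal_pos (measure_closedBall_pos ν p hρ0).ne' measure_closedBall_lt_top.ne
  have hlower : ∀ k : ℕ, r' ^ k * v ≤ ∫ x in closedBall 0 R, (1 - ‖x - p‖ ^ 2 / S) ^ k ∂ν := by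
    intro k
    have hi : IntegrableOn (fun x => (1 - ‖x - p‖ ^ 2 / S) ^ k) (closedBall 0 R) ν :=
      (Continuous.continuousOn (by fun_prop)).integrableOn_compact hcomp
    calc r' ^ k * v = ∫ x in closedBall p ρ, r' ^ k ∂ν := by
          rw [setIntegral_const, smul_eq_mul, mul_comm]
      _ ≤ ∫ x in closedBall p ρ, (1 - ‖x - p‖ ^ 2 / S) ^ k ∂ν := by
          refine setIntegral_mono_on ?_ (hi.mono_set hsub) isClosed_closedBall.measurableSet
            fun x hx => ?_
          · exact integrableOn_const measure_closedBall_lt_top.ne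
          · have : ‖x - p‖ ^ 2 ≤ δ / 2 := by
              rw [mem_closedBall, dist_eq_norm] at hx
              rw [← Real.sq_sqrt (by positivity : 0 ≤ δ / 2)]
              exact pow_le_pow_left₀ (norm_nonneg _) (hx.trans (min_le_right _ _)) 2
            simp only [r']
            gcongr
      _ ≤ _ := by
          refine setIntegral_mono_set hi ?_ (LE.le.eventuallyLE hsub)
          refine (ae_restrict_iff' hcomp.measurableSet).2 (.of_forall fun x hx => ?_)
          refine pow_nonneg (sub_nonneg.2 ((div_le_one hS0).2 ?_)) k
          have := hx₂ x hx
          rw [hS]; linarith [sq_nonneg ‖x₁ + h x₁ - p‖]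
  have hlim : Filter.Tendsto (fun k : ℕ => (r / r') ^ k * C) Filter.atTop (nhds (0 * C)) :=
    (tendsto_pow_atTop_nhds_zero_of_lt_one (by positivity) ((div_lt_one hr'0).2 hrr')).mul_const C
  have : v ≤ 0 * C := by
    refine ge_of_tendsto' hlim fun k => ?_
    rw [div_pow, div_mul_eq_mul_div, le_div_iff₀ (by positivity), mul_comm]
    exact (hlower k).trans (hupper k)
  linarith

/-- If outside a ball some coordinate of `H u` has the strict sign of the same coordinate of
`u - c`, then `H` vanishes somewhere in the ball. -/
theorem exists_zero_of_outward_coordinate {ι : Type*} [Fintype ι]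
    {H : EuclideanSpace ℝ ι → EuclideanSpace ℝ ι} (hH : ContDiff ℝ 1 H)
    (c : EuclideanSpace ℝ ι) (r : ℝ)
    (hout : ∀ u, r < ‖u‖ → ∃ x, 0 < H u x * (u x - c x)) : ∃ u, H u = 0 := by
  let χ : ContDiffBump (0 : EuclideanSpace ℝ ι) :=
    ⟨max r 1, max r 1 + 1, by positivity, by linarith⟩
  have hχ : ContDiff ℝ 1 χ := χ.contDiff
  have hχs : HasCompactSupport χ := χ.hasCompactSupport
  -- The perturbed map interpolates between `H u + c` near the origin and the identity far away. A
  -- preimage of `c` makes a convex combination of `H u` and `u - c` vanish, which the sign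
  -- condition forbids outside the ball.
  obtain ⟨u, hu⟩ := surjective_add_of_hasCompactSupport
    (h := fun u => χ u • (H u - (u - c))) (by fun_prop) hχs.smul_right c
  have hcomb : ∀ x, χ u * H u x + (1 - χ u) * (u x - c x) = 0 := fun x => by
    have := congrArg (fun w : EuclideanSpace ℝ ι => w x) hu
    simp at this
    linarith
  have hle : ‖u‖ ≤ r := by
    by_contra! hlt
    obtain ⟨x, hx⟩ := hout u hlt
    have h0 : 0 ≤ χ u := χ.nonneg
    have h1 : χ u ≤ 1 := χ.le_one
    have hsq : 0 < (u x - c x) ^ 2 := by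
      have : u x - c x ≠ 0 := right_ne_zero_of_mul hx.ne'
      positivity
    have hz : χ u * (H u x * (u x - c x)) + (1 - χ u) * (u x - c x) ^ 2 = 0 := by
      linear_combination (u x - c x) * hcomb x
    rcases h0.eq_or_lt with h | h
    · rw [← h] at hz; linarith
    · nlinarith [mul_pos h hx, mul_nonneg (sub_nonneg.2 h1) hsq.le]
  have hχ1 : χ u = 1 := χ.one_of_mem_closedBall (by
    rw [mem_closedBall_zero_iff]
    exact hle.trans (le_max_left _ _))
  refine ⟨u, ?_⟩
  ext x
  simpa [hχ1] using hcomb x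

/-! ### Logit equilibria at positive temperature -/

open Filter in
/-- The matching function with exponential (Logit) demand attains every positive margin. -/
theorem exists_logit_equilibrium {ι A : Type*} [Fintype ι] [Fintype A] {B C : ι → A → ℝ}
    (hB : ∀ x a, 0 ≤ B x a) (hC : ∀ x a, 0 ≤ C x a) (hBC : ∀ x a, 0 < B x a → 0 < C x a)
    (hsingle : ∀ x, ∃ a, 0 < B x a ∧ ∀ y, y ≠ x → C y a = 0) (Φ : A → ℝ) {n : ι → ℝ}
    (hn : ∀ x, 0 < n x) :
    ∃ u : ι → ℝ, ∀ x, ∑ a, B x a * Real.exp (Φ a - ∑ y, C y a * u y) = n x := by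
  classical
  choose s hsB hsC using hsingle
  have hsum : ∀ (u : ι → ℝ) x, ∑ y, C y (s x) * u y = C x (s x) * u x := fun u x =>
    Finset.sum_eq_single x (fun y _ hy => by rw [hsC x y hy, zero_mul]) (by simp)
  -- At utility `l x` the single arrangement alone absorbs exactly `n x`, whatever the other
  -- utilities.
  let l : ι → ℝ := fun x => (Φ (s x) - Real.log (n x / B x (s x))) / C x (s x)
  have hlow : ∀ (u : ι → ℝ) x, u x < l x →
      n x < ∑ a, B x a * Real.exp (Φ a - ∑ y, C y a * u y) := by
    intro u x hux
    have hb := hsB x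
    have hnb : 0 < n x / B x (s x) := div_pos (hn x) hb
    refine lt_of_lt_of_le ?_ (Finset.single_le_sum (fun a _ => mul_nonneg (hB x a)
      (Real.exp_pos _).le) (Finset.mem_univ (s x)))
    rw [hsum, mul_comm, ← div_lt_iff₀ hb, ← Real.log_lt_iff_lt_exp hnb]
    have := (lt_div_iff₀ (hBC x _ hb)).1 hux
    linarith
  have hup : ∀ x, ∃ M, l x ≤ M ∧ ∀ t, M ≤ t →
      ∑ a, B x a * Real.exp (Φ a - ∑ y, C y a * l y - C x a * (t - l x)) < n x := by
    intro x
    have hlim : Tendsto (fun t => ∑ a, B x a *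
        Real.exp (Φ a - ∑ y, C y a * l y - C x a * (t - l x))) atTop (nhds (∑ _a : A, 0)) := by
      refine tendsto_finsetSum _ fun a _ => ?_
      rcases (hB x a).eq_or_lt with h | h
      · simp [← h]
      · rw [← mul_zero (B x a)]
        refine (Real.tendsto_exp_atBot.comp ?_).const_mul _
        refine tendsto_atBot_add_const_left _ _ (tendsto_neg_atTop_atBot.comp ?_)
        exact (tendsto_atTop_add_const_right _ _ tendsto_id).const_mul_atTop (hBC x a h)
    rw [Finset.sum_const_zero] at hlim
    obtain ⟨M, hM⟩ := eventually_atTop.1 (hlim.eventually_lt_const (hn x))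
    exact ⟨max M (l x), le_max_right _ _, fun t ht => hM t ((le_max_left _ _).trans ht)⟩
  choose U hlU hU using hup
  have hhigh : ∀ (u : ι → ℝ) x, (∀ y, l y ≤ u y) → U x < u x →
      ∑ a, B x a * Real.exp (Φ a - ∑ y, C y a * u y) < n x := by
    intro u x hl hux
    refine lt_of_le_of_lt (Finset.sum_le_sum fun a _ => ?_) (hU x (u x) hux.le)
    refine mul_le_mul_of_nonneg_left (Real.exp_le_exp.2 ?_) (hB x a)
    have := Finset.single_le_sum (f := fun y => C y a * (u y - l y))
      (fun y _ => mul_nonneg (hC y a) (sub_nonneg.2 (hl y))) (Finset.mem_univ x)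
    simp only [mul_sub, Finset.sum_sub_distrib] at this
    linarith
  let H : EuclideanSpace ℝ ι → EuclideanSpace ℝ ι := fun u =>
    WithLp.toLp 2 fun x => n x - ∑ a, B x a * Real.exp (Φ a - ∑ y, C y a * u y)
  have hH : ContDiff ℝ 1 H := by
    rw [contDiff_euclidean]
    intro x
    simp only [H]
    fun_prop
  obtain ⟨r, hr⟩ := ((isCompact_Icc (a := l) (b := U)).image
    (PiLp.continuous_toLp 2 fun _ : ι => ℝ)).isBounded.exists_norm_le
  -- The centre is the corner `l`: `hhigh` needs all coordinates above `l`, and any coordinate below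
  -- `l` already has the required sign.
  obtain ⟨u, hu⟩ := exists_zero_of_outward_coordinate hH (WithLp.toLp 2 l) r fun u hru => by
    by_cases hl : ∀ y, l y ≤ u y
    · have hnot : ∃ x, U x < u x := by
        by_contra! hle
        exact hru.not_ge (hr u ⟨u.ofLp, ⟨hl, hle⟩, rfl⟩)
      obtain ⟨x, hx⟩ := hnot
      exact ⟨x, mul_pos (sub_pos.2 (hhigh u x hl hx)) (sub_pos.2 ((hlU x).trans_lt hx))⟩
    · push Not at hl
      obtain ⟨x, hx⟩ := hl
      exact ⟨x, mul_pos_of_neg_of_neg (sub_neg.2 (hlow u x hx)) (sub_neg.2 hx)⟩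
  refine ⟨u, fun x => ?_⟩
  have := congrArg (fun w : EuclideanSpace ℝ ι => w x) hu
  simp only [H, PiLp.zero_apply] at this
  linarith

/-- The Logit equilibrium with temperature `T`, together with bounds on it that do not depend
on `T`. -/
theorem exists_bounds_logit_equilibrium {ι A : Type*} [Fintype ι] [Fintype A] {B C : ι → A → ℝ}
    (hB : ∀ x a, 0 ≤ B x a) (hC : ∀ x a, 0 ≤ C x a) (hBC : ∀ x a, 0 < B x a → 0 < C x a)
    (hsingle : ∀ x, ∃ a, 0 < B x a ∧ ∀ y, y ≠ x → C y a = 0) (hne : ∀ a, ∃ x, 0 < B x a)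
    (Φ : A → ℝ) {n : ι → ℝ} (hn : ∀ x, 0 ≤ n x) :
    ∃ (M : ℝ) (l U : ι → ℝ), ∀ T, 0 < T → T ≤ 1 → ∃ (μ : A → ℝ) (u : ι → ℝ),
      (∀ a, 0 < μ a ∧ μ a ≤ M) ∧ (∀ x, l x ≤ u x ∧ u x ≤ U x) ∧
      (∀ x, ∑ a, B x a * μ a = n x + T) ∧
      ∀ a, T * Real.log (μ a) = Φ a - ∑ y, C y a * u y := by
  classical
  choose w hw using hne
  choose s hsB hsC using id hsingle
  let M : ℝ := 1 + ∑ a, (n (w a) + 1) / B (w a) a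
  have hM : ∀ a, (n (w a) + 1) / B (w a) a ≤ M := fun a => by
    have := Finset.single_le_sum (f := fun a => (n (w a) + 1) / B (w a) a)
      (fun a _ => div_nonneg (by linarith [hn (w a)]) (hB _ _)) (Finset.mem_univ a)
    simp only [M]; linarith
  have hM1 : 1 ≤ M := by
    simp only [M]
    linarith [Finset.sum_nonneg fun a (_ : a ∈ Finset.univ) =>
      div_nonneg (by linarith [hn (w a)] : (0 : ℝ) ≤ n (w a) + 1) (hB (w a) a)]
  let l : ι → ℝ := fun x => (Φ (s x) - Real.log M) / C x (s x)
  let D : ℝ := 1 + ∑ x, ∑ a, B x a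
  have hD0 : ∀ x, ∑ a, B x a < D := fun x => by
    have := Finset.single_le_sum (f := fun x => ∑ a, B x a)
      (fun x _ => Finset.sum_nonneg fun a _ => hB x a) (Finset.mem_univ x)
    simp only [D]; linarith
  -- This bounds `u x` once `T * log (μ a) ≥ -D`. The arrangement achieving that may vary with `T`,
  -- so the upper bound sums over all `a`.
  let E : ι → A → ℝ := fun x a => |Φ a + D - ∑ y ∈ Finset.univ.erase x, C y a * l y| / C x a
  refine ⟨M, l, fun x => ∑ a, E x a, fun T hT0 hT1 => ?_⟩
  obtain ⟨u', hu'⟩ := exists_logit_equilibrium hB hC hBC hsingle (fun a => Φ a / T)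
    (n := fun x => n x + T) fun x => by linarith [hn x]
  let u : ι → ℝ := fun x => T * u' x
  let μ : A → ℝ := fun a => Real.exp (Φ a / T - ∑ y, C y a * u' y)
  have hlog : ∀ a, T * Real.log (μ a) = Φ a - ∑ y, C y a * u y := fun a => by
    simp only [μ, u, Real.log_exp, mul_sub, Finset.mul_sum, mul_div_cancel₀ _ hT0.ne']
    congr 1
    exact Finset.sum_congr rfl fun y _ => by ring
  have hμ0 : ∀ a, 0 < μ a := fun a => Real.exp_pos _
  have hμM : ∀ a, μ a ≤ M := fun a => by
    refine le_trans ?_ (hM a)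
    rw [le_div_iff₀ (hw a), mul_comm]
    have h1 := Finset.single_le_sum (f := fun b => B (w a) b * μ b)
      (fun b _ => mul_nonneg (hB _ b) (hμ0 b).le) (Finset.mem_univ a)
    exact (h1.trans_eq (hu' (w a))).trans (by linarith)
  have hl : ∀ x, l x ≤ u x := fun x => by
    have h1 := hlog (s x)
    rw [Finset.sum_eq_single x (fun y _ hy => by rw [hsC x y hy, zero_mul]) (by simp)] at h1
    have h2 : T * Real.log (μ (s x)) ≤ Real.log M :=
      (mul_le_mul_of_nonneg_left (Real.log_le_log (hμ0 _) (hμM _)) hT0.le).trans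
        (mul_le_of_le_one_left (Real.log_nonneg hM1) hT1)
    rw [div_le_iff₀ (hBC x _ (hsB x))]
    linarith
  refine ⟨μ, u, fun a => ⟨hμ0 a, hμM a⟩, fun x => ⟨hl x, ?_⟩, hu', hlog⟩
  have hDpos : 0 < D := lt_of_le_of_lt (Finset.sum_nonneg fun a _ => hB x a) (hD0 x)
  -- The extra mass `T` keeps some `μ a` from being too small even when `n x = 0`, and `T * log (T /
  -- D) ≥ T - D`.
  obtain ⟨a, ha, hTa⟩ : ∃ a, 0 < B x a ∧ T / D ≤ μ a := by
    by_contra! hlt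
    have h1 : ∑ a, B x a * μ a ≤ ∑ a, B x a * (T / D) := Finset.sum_le_sum fun a _ => by
      rcases (hB x a).eq_or_lt with h | h
      · simp [← h]
      · exact mul_le_mul_of_nonneg_left (hlt a h).le h.le
    have h2 : ∑ a, B x a * (T / D) < T := by
      rw [← Finset.sum_mul, mul_div_assoc', div_lt_iff₀ hDpos, mul_comm]
      exact mul_lt_mul_of_pos_left (hD0 x) hT0
    have h3 := hu' x
    linarith [hn x]
  have hTlog : -D ≤ T * Real.log (μ a) := by
    have h1 := Real.log_le_log (div_pos hT0 hDpos) hTa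
    have h2 := Real.one_sub_inv_le_log_of_pos (div_pos hT0 hDpos)
    have h3 := mul_le_mul_of_nonneg_left (h2.trans h1) hT0.le
    rw [inv_div, mul_sub, mul_div_cancel₀ _ hT0.ne'] at h3
    linarith
  have hCa := hBC x a ha
  refine le_trans ?_ (Finset.single_le_sum (f := E x)
    (fun a _ => div_nonneg (abs_nonneg _) (hC x a)) (Finset.mem_univ a))
  rw [le_div_iff₀ hCa]
  refine le_trans ?_ (le_abs_self _)
  have h1 := hlog a
  rw [← Finset.add_sum_erase _ _ (Finset.mem_univ x)] at h1
  have h2 : ∑ y ∈ Finset.univ.erase x, C y a * l y ≤ ∑ y ∈ Finset.univ.erase x, C y a * u y :=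
    Finset.sum_le_sum fun y _ => mul_le_mul_of_nonneg_left (hl y) (hC y a)
  linarith

/-! ### The zero-temperature limit -/

open Filter Topology in
/-- Existence of a stable outcome, for nonnegative matrices of memberships `B` and of transfer
coefficients `C`. -/
theorem exists_stable_of_matrices {ι A : Type*} [Fintype ι] [Fintype A] {B C : ι → A → ℝ}
    (hB : ∀ x a, 0 ≤ B x a) (hC : ∀ x a, 0 ≤ C x a) (hBC : ∀ x a, 0 < B x a → 0 < C x a)
    (hsingle : ∀ x, ∃ a, 0 < B x a ∧ ∀ y, y ≠ x → C y a = 0) (hne : ∀ a, ∃ x, 0 < B x a)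
    (Φ : A → ℝ) {n : ι → ℝ} (hn : ∀ x, 0 ≤ n x) :
    ∃ (μ : A → ℝ) (u : ι → ℝ), (∀ a, 0 ≤ μ a) ∧ (∀ x, ∑ a, B x a * μ a = n x) ∧
      (∀ a, Φ a ≤ ∑ y, C y a * u y) ∧ ∀ a, 0 < μ a → ∑ y, C y a * u y = Φ a := by
  obtain ⟨M, l, U, h⟩ := exists_bounds_logit_equilibrium hB hC hBC hsingle hne Φ hn
  let T : ℕ → ℝ := fun k => 1 / ((k : ℝ) + 1)
  have hT0 : ∀ k, 0 < T k := fun k => Nat.one_div_pos_of_nat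
  have hT1 : ∀ k, T k ≤ 1 := fun k => by
    rw [div_le_one (by positivity)]
    linarith [(Nat.cast_nonneg k : (0 : ℝ) ≤ k)]
  have hTlim : Tendsto T atTop (𝓝 0) := tendsto_one_div_add_atTop_nhds_zero_nat
  choose μ u hμ hu hfeas hlog using fun k => h (T k) (hT0 k) (hT1 k)
  have hcomp : IsCompact (Set.Icc (0 : A → ℝ) (fun _ => M) ×ˢ Set.Icc l U) :=
    isCompact_Icc.prod isCompact_Icc
  obtain ⟨⟨μ', u'⟩, -, φ, hφ, hlim⟩ := hcomp.tendsto_subseq (x := fun k => (μ k, u k)) fun k =>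
    ⟨⟨fun a => (hμ k a).1.le, fun a => (hμ k a).2⟩, fun x => (hu k x).1, fun x => (hu k x).2⟩
  rw [nhds_prod_eq, tendsto_prod_iff'] at hlim
  have hμlim := tendsto_pi_nhds.1 hlim.1
  have hulim := tendsto_pi_nhds.1 hlim.2
  have hTφ := hTlim.comp hφ.tendsto_atTop
  have hslack : ∀ a, Tendsto (fun k => Φ a - ∑ y, C y a * u (φ k) y) atTop
      (𝓝 (Φ a - ∑ y, C y a * u' y)) := fun a =>
    tendsto_const_nhds.sub (tendsto_finsetSum _ fun y _ => (hulim y).const_mul _)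
  refine ⟨μ', u', fun a => ?_, fun x => ?_, fun a => ?_, fun a ha => ?_⟩
  · exact ge_of_tendsto' (hμlim a) fun k => (hμ (φ k) a).1.le
  · have h1 : Tendsto (fun k => ∑ a, B x a * μ (φ k) a) atTop (𝓝 (∑ a, B x a * μ' a)) :=
      tendsto_finsetSum _ fun a _ => (hμlim a).const_mul _
    have h2 := hTφ.const_add (n x)
    rw [add_zero] at h2
    exact tendsto_nhds_unique h1 (h2.congr fun k => (hfeas (φ k) x).symm)
  · have h1 := hTφ.mul_const (Real.log M)
    rw [zero_mul] at h1
    have h2 := le_of_tendsto_of_tendsto' (hslack a) h1 fun k => by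
      rw [← hlog]
      exact mul_le_mul_of_nonneg_left (Real.log_le_log (hμ _ a).1 (hμ _ a).2) (hT0 _).le
    linarith
  · have h1 := hTφ.mul ((hμlim a).log ha.ne')
    rw [zero_mul] at h1
    have h2 := tendsto_nhds_unique (hslack a) (h1.congr fun k => hlog (φ k) a)
    linarith

/-! ### Specialization to the two matching models -/

theorem LTUProblem.exists_isStable {X : Type*} [Fintype X] [DecidableEq X] {N : ℕ}
    (P : LTUProblem X N) : ∃ (μ : P.allowed → ℝ) (u : X → ℝ), P.IsStable μ u := by
  let C : X → P.allowed → ℝ := fun x a => ∑ i, if a.1 i = some x then P.coeff a i else 0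
  have hterm : ∀ x a i, 0 ≤ if a.1 i = some x then P.coeff a i else 0 := fun x a i => by
    split_ifs
    exacts [P.coeff_nonneg a i, le_rfl]
  have hcount : ∀ x (a : P.allowed), (0 : ℝ) < count x a.1 ↔ ∃ i, a.1 i = some x := fun x a => by
    rw [Nat.cast_pos, count, Finset.card_pos]
    simp [Finset.Nonempty]
  have hutil : ∀ u a, ∑ y, C y a * u y = P.weightedUtility u a := fun u a => by
    simp only [C, weightedUtility, Finset.sum_mul]
    rw [Finset.sum_comm]
    refine Finset.sum_congr rfl fun i _ => ?_
    rcases h : a.1 i with _ | x <;> simp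
  have key := exists_stable_of_matrices
    (B := fun x (a : P.allowed) => (count x a.1 : ℝ)) (C := C) (n := P.mass)
    (fun x a => Nat.cast_nonneg _) (fun x a => Finset.sum_nonneg fun i _ => hterm x a i)
    (fun x a h => ?_) (fun x => ?_) (fun a => ?_) P.output P.mass_nonneg
  · obtain ⟨μ, u, h1, h2, h3, h4⟩ := key
    exact ⟨μ, u, h1, h2, fun a => hutil u a ▸ h3 a, fun a ha => hutil u a ▸ h4 a ha⟩
  · obtain ⟨i, hi⟩ := (hcount x a).1 h
    refine Finset.sum_pos' (fun i _ => hterm x a i) ⟨i, Finset.mem_univ i, ?_⟩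
    rw [if_pos hi]
    refine lt_of_le_of_ne (P.coeff_nonneg a i) fun h0 => ?_
    simp [(P.coeff_eq_zero_iff a i).1 h0.symm] at hi
  · obtain ⟨a, ha, i, hi, hj⟩ := P.exists_single x
    refine ⟨⟨a, ha⟩, (hcount x _).2 ⟨i, hi⟩, fun y hy => Finset.sum_eq_zero fun j _ => ?_⟩
    rw [if_neg]
    by_cases hji : j = i
    · subst hji
      simpa [hi] using hy.symm
    · simp [hj j hji]
  · by_contra! hno
    refine P.empty_notMem ?_
    convert a.2 using 1
    funext i
    by_contra hi
    obtain ⟨x, hx⟩ := Option.ne_none_iff_exists'.1 (Ne.symm hi)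
    exact (hno x).not_gt ((hcount x a).2 ⟨i, hx⟩)

theorem TwoSidedLTUProblem.exists_isStable {X Y : Type*} [Fintype X] [Fintype Y]
    (P : TwoSidedLTUProblem X Y) :
    ∃ (μ : X → Y → ℝ) (u : X → ℝ) (v : Y → ℝ), P.IsStable μ u v := by
  classical
  -- Remaining unmatched is an arrangement whose output is the reservation utility. Its mass turns
  -- the feasibility inequalities into equalities, and must vanish when utility exceeds reservation.
  let B : X ⊕ Y → (X × Y) ⊕ (X ⊕ Y) → ℝ := fun i => Sum.elim
    (fun p => (if i = Sum.inl p.1 then 1 else 0) + if i = Sum.inr p.2 then 1 else 0)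
    (fun j => if i = j then 1 else 0)
  let C : X ⊕ Y → (X × Y) ⊕ (X ⊕ Y) → ℝ := fun i => Sum.elim
    (fun p => (if i = Sum.inl p.1 then P.lam p.1 p.2 else 0) +
      if i = Sum.inr p.2 then 1 - P.lam p.1 p.2 else 0)
    (fun j => if i = j then 1 else 0)
  have hlam : ∀ x y, 0 < 1 - P.lam x y := fun x y => sub_pos.2 (P.lam_lt_one x y)
  have key := exists_stable_of_matrices (B := B) (C := C)
    (n := Sum.elim P.n P.m) ?_ ?_ ?_ (fun i => ⟨Sum.inr i, ?_⟩) ?_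
    (Sum.elim (fun p => P.Φ p.1 p.2 / 2) (Sum.elim P.u₀ P.v₀)) ?_
  · obtain ⟨μ, w, h1, h2, h3, h4⟩ := key
    have hpair : ∀ x y, ∑ i, C i (Sum.inl (x, y)) * w i =
        P.lam x y * w (Sum.inl x) + (1 - P.lam x y) * w (Sum.inr y) := fun x y => by
      simp [C, Fintype.sum_sum_type]
    have hone : ∀ j, ∑ i, C i (Sum.inr j) * w i = w j := fun j => by simp [C]
    have hx : ∀ x, ∑ y, μ (Sum.inl (x, y)) + μ (Sum.inr (Sum.inl x)) = P.n x := fun x => by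
      have := h2 (Sum.inl x)
      simpa [B, Fintype.sum_sum_type, Fintype.sum_prod_type_right] using this
    have hy : ∀ y, ∑ x, μ (Sum.inl (x, y)) + μ (Sum.inr (Sum.inr y)) = P.m y := fun y => by
      have := h2 (Sum.inr y)
      simpa [B, Fintype.sum_sum_type, Fintype.sum_prod_type] using this
    refine ⟨fun x y => μ (Sum.inl (x, y)), fun x => w (Sum.inl x), fun y => w (Sum.inr y),
      fun x y => h1 _, fun x => ?_, fun y => ?_, fun x y => ?_, fun x => ?_, fun y => ?_,
      fun x y hxy => ?_, fun x hux => ?_, fun y hvy => ?_⟩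
    · simpa [hone] using h3 (Sum.inr (Sum.inl x))
    · simpa [hone] using h3 (Sum.inr (Sum.inr y))
    · simpa [hpair] using h3 (Sum.inl (x, y))
    · linarith [hx x, h1 (Sum.inr (Sum.inl x))]
    · linarith [hy y, h1 (Sum.inr (Sum.inr y))]
    · simpa [hpair] using h4 (Sum.inl (x, y)) hxy
    · have h0 : μ (Sum.inr (Sum.inl x)) = 0 := by
        refine le_antisymm (not_lt.1 fun hpos => hux.ne' ?_) (h1 _)
        simpa [hone] using h4 _ hpos
      linarith [hx x]
    · have h0 : μ (Sum.inr (Sum.inr y)) = 0 := by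
        refine le_antisymm (not_lt.1 fun hpos => hvy.ne' ?_) (h1 _)
        simpa [hone] using h4 _ hpos
      linarith [hy y]
  · rintro i (p | j) <;> simp only [B, Sum.elim_inl, Sum.elim_inr] <;> positivity
  · rintro i (p | j) <;> simp only [C, Sum.elim_inl, Sum.elim_inr]
    · have := P.lam_pos p.1 p.2
      have := hlam p.1 p.2
      positivity
    · positivity
  · rintro (x | y) (p | j) h
    · by_cases hp : x = p.1
      · simpa [C, hp] using P.lam_pos p.1 p.2
      · simp [B, hp] at h
    · exact h
    · by_cases hp : y = p.2
      · simpa [C, hp] using P.lam_lt_one p.1 p.2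
      · simp [B, hp] at h
    · exact h
  · exact ⟨by simp [B], fun j hj => by simp [C, hj]⟩
  · rintro (p | j)
    · exact ⟨Sum.inl p.1, by simp [B]⟩
    · exact ⟨j, by simp [B]⟩
  · rintro (x | y)
    exacts [P.n_nonneg x, P.m_nonneg y]

theorem corollary1 :
    (∀ (X : Type*) [Fintype X] [DecidableEq X] (N : ℕ) (P : LTUProblem X N),
      ∃ (μ : P.allowed → ℝ) (u : X → ℝ), P.IsStable μ u) ∧
    (∀ (X : Type*) (Y : Type*) [Fintype X] [Fintype Y] (P : TwoSidedLTUProblem X Y),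
      ∃ (μ : X → Y → ℝ) (u : X → ℝ) (v : Y → ℝ), P.IsStable μ u v) :=
  ⟨fun _ _ _ _ P => P.exists_isStable, fun _ _ _ _ P => P.exists_isStable⟩
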